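/- Let $E$ be a complex vector space of dimension $2$, let $f, g$ be linear endomorphisms of $E$, let $\mathrm{id}$ be the identity of $E$, and let $\mathcal{U} = \{u \in \mathbb{C} : u \neq 0,\ e^u = 1 + u\}$. Then $$f\circ g \neq g\circ f \quad\text{and}\quad \exp(t f + g) = \exp(t f)\circ \exp(g) \ \text{ for all } t \in \mathbb{C}$$ if and only if there exist $\sigma, \tau \in \mathbb{C}$ such that $\tilde f = f - \sigma\,\mathrm{id}$ and $\tilde g = g - \tau\,\mathrm{id}$ satisfy $$\tilde f \neq 0, \qquad \tilde f^2 = 0, \qquad \tilde f\circ \tilde g = 0 \qquad\text{and}\qquad \operatorname{tr}(\tilde g) \in \mathcal{U}.$$ -/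

import Mathlib

/-- The exponential `∑ fⁿ / n!` of an endomorphism of a complex vector space `E`. The sum is taken
in the module topology of `End E`, which for finite-dimensional `E` is the topology of any norm
on `End E`. -/
noncomputable def endExp {E : Type*} [AddCommGroup E] [Module ℂ E] (f : Module.End ℂ E) :
    Module.End ℂ E :=
  letI : TopologicalSpace (Module.End ℂ E) := moduleTopology ℂ (Module.End ℂ E)
  ∑' n : ℕ, ((n.factorial : ℂ)⁻¹) • f ^ n

/-- In any finite basis, `endExp` is represented by the usual matrix exponential. -/
theorem toMatrix_endExp {E : Type*} [AddCommGroup E] [Module ℂ E] {n : Type*} [Fintype n]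
    [DecidableEq n] (b : Module.Basis n ℂ E) (f : Module.End ℂ E) :
    LinearMap.toMatrix b b (endExp f) = NormedSpace.exp (LinearMap.toMatrix b b f) := by
  let _ : TopologicalSpace (Module.End ℂ E) := moduleTopology ℂ (Module.End ℂ E)
  have : IsModuleTopology ℂ (Module.End ℂ E) := ⟨rfl⟩
  have : IsModuleTopology ℂ (Matrix n n ℂ) :=
    inferInstanceAs (IsModuleTopology ℂ (n → n → ℂ))
  let e : Module.End ℂ E ≃ₗ[ℂ] Matrix n n ℂ := LinearMap.toMatrix b b
  have : ContinuousAdd (Module.End ℂ E) := ModuleTopology.continuousAdd ℂ _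
  have hc : Continuous e := IsModuleTopology.continuous_of_linearMap e.toLinearMap
  have hc' : Continuous e.symm := IsModuleTopology.continuous_of_linearMap e.symm.toLinearMap
  let h : Module.End ℂ E ≃ₜ Matrix n n ℂ := ⟨e.toEquiv, hc, hc'⟩
  have : T2Space (Module.End ℂ E) := h.symm.t2Space
  have hp : ∀ k : ℕ, e (f ^ k) = (e f) ^ k := fun k => map_pow (LinearMap.toMatrixAlgEquiv b) f k
  change e (∑' k : ℕ, ((k.factorial : ℂ)⁻¹) • f ^ k) = NormedSpace.exp (e f)
  rw [NormedSpace.exp_eq_tsum ℂ, show e (∑' k : ℕ, ((k.factorial : ℂ)⁻¹) • f ^ k) =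
    ∑' k : ℕ, e (((k.factorial : ℂ)⁻¹) • f ^ k) from
    (ContinuousLinearEquiv.mk e hc hc').map_tsum]
  simp [hp]

/-- The set of nonzero complex numbers `u` with `e ^ u = 1 + u`. -/
def setU : Set ℂ := {u | u ≠ 0 ∧ Complex.exp u = 1 + u}

/-! Adding scalars to `f` and `g` changes neither condition on the left, so both may be taken
traceless, as matrices A and B. A traceless 2×2 matrix squares to a scalar δ², hence its exponential
is cosh δ + (sinh δ / δ)A, with trace 2 cosh δ. If A² ≠ 0, rescale to A² = 1. Traces turn the
hypothesis into an identity for cosh √(s² + d), which forces d = 0 by comparing zeros; evaluation at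
two values of t then gives B = xA, so A and B commute. Hence A² = 0. Now cosh √(tb + c) is affine in
t, so b = tr(AB) = 0, and t = 1 yields AB = lA with -2l in `setU`. Conversely, AB = A² = 0 and u =
tr B give (tA + B)² = u(tA + B), and e^u = 1 + u makes exp X = 1 + X for both X = tA + B and X = B.
-/

section Exponential

/-! ### Exponentials of elements satisfying a quadratic equation. -/

variable {𝔸 : Type*} [NormedRing 𝔸] [NormedAlgebra ℂ 𝔸] [CompleteSpace 𝔸]

theorem exp_eq_one_add_of_mul_self_eq_zero {a : 𝔸} (h : a * a = 0) :
    NormedSpace.exp a = 1 + a := by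
  have hs := NormedSpace.exp_series_hasSum_exp' (𝕂 := ℂ) a
  refine hs.unique ?_
  have h2 : ∀ n ∉ Finset.range 2, ((n.factorial : ℂ)⁻¹) • a ^ n = 0 := by
    intro n hn
    obtain ⟨k, rfl⟩ : ∃ k, n = 2 + k := Nat.exists_eq_add_of_le (by simpa [Nat.succ_le_iff] using hn)
    rw [pow_add, pow_two, h, zero_mul, smul_zero]
  simpa [Finset.sum_range_succ] using hasSum_sum_of_ne_finset_zero h2

theorem exp_smul_of_isIdempotentElem {p : 𝔸} (hp : IsIdempotentElem p) (u : ℂ) :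
    NormedSpace.exp (u • p) = 1 + (Complex.exp u - 1) • p := by
  have hs := NormedSpace.exp_series_hasSum_exp' (𝕂 := ℂ) (u • p)
  refine hs.unique ?_
  have h1 : HasSum (fun n : ℕ => ((n.factorial : ℂ)⁻¹ • u ^ n) • p) (Complex.exp u • p) := by
    rw [Complex.exp_eq_exp_ℂ]
    exact (NormedSpace.exp_series_hasSum_exp' (𝕂 := ℂ) u).smul_const p
  have h2 : HasSum (fun n : ℕ => if n = 0 then 1 - p else 0) (1 - p) := hasSum_ite_eq 0 (1 - p)
  convert h1.add h2 using 1
  · funext n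
    rcases n with _ | n
    · simp
    · simp [smul_pow, hp.pow_succ_eq, smul_smul]
  · rw [sub_smul, one_smul]
    abel

theorem exp_add_smul_one (a : 𝔸) (z : ℂ) :
    NormedSpace.exp (a + z • (1 : 𝔸)) = Complex.exp z • NormedSpace.exp a := by
  let +nondep : NormedAlgebra ℚ 𝔸 := .restrictScalars ℚ ℂ 𝔸
  have hz : NormedSpace.exp (z • (1 : 𝔸)) = Complex.exp z • (1 : 𝔸) := by
    rw [exp_smul_of_isIdempotentElem IsIdempotentElem.one, sub_smul, one_smul]
    abel
  rw [NormedSpace.exp_add_of_commute ((Commute.one_right a).smul_right z), hz, mul_smul_comm,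
    mul_one]

theorem exp_of_mul_self_eq_smul {b : 𝔸} {u : ℂ} (hu : u ≠ 0) (h : b * b = u • b) :
    NormedSpace.exp b = 1 + ((Complex.exp u - 1) / u) • b := by
  have hp : IsIdempotentElem (u⁻¹ • b) := by
    rw [IsIdempotentElem, smul_mul_smul_comm, h, smul_smul]
    congr 1
    field_simp
  have := exp_smul_of_isIdempotentElem hp u
  rwa [smul_smul, smul_smul, mul_inv_cancel₀ hu, one_smul, ← div_eq_mul_inv] at this

variable (𝔸) in
-- The coefficient `S` stands for sinh δ / δ, with value 1 at δ = 0. It depends on `δ` alone, so all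
-- elements with the same square share it.
theorem exists_exp_eq_cosh_add (δ : ℂ) :
    ∃ S : ℂ, S * δ = Complex.sinh δ ∧ ∀ a : 𝔸, a * a = δ ^ 2 • (1 : 𝔸) →
      NormedSpace.exp a = Complex.cosh δ • (1 : 𝔸) + S • a := by
  rcases eq_or_ne δ 0 with rfl | hδ
  · exact ⟨1, by simp, fun a h => by
      rw [exp_eq_one_add_of_mul_self_eq_zero (by simpa using h)]; simp⟩
  · refine ⟨Complex.sinh δ / δ, by field_simp, fun a h => ?_⟩
    -- Shifting by δ makes the element a multiple of an idempotent.
    have h2 : (a + δ • (1 : 𝔸)) * (a + δ • (1 : 𝔸)) = (2 * δ) • (a + δ • (1 : 𝔸)) := by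
      simp only [mul_add, add_mul, h, mul_smul_comm, smul_mul_assoc, mul_one, one_mul]
      module
    have h3 := exp_of_mul_self_eq_smul (mul_ne_zero two_ne_zero hδ) h2
    have h4 := exp_add_smul_one (a + δ • (1 : 𝔸)) (-δ)
    rw [neg_smul, add_neg_cancel_right, h3] at h4
    have h5 : Complex.exp (2 * δ) = Complex.exp δ * Complex.exp δ := by
      rw [← Complex.exp_add, two_mul]
    have h6 : Complex.exp (-δ) * Complex.exp δ = 1 := by rw [← Complex.exp_add]; simp
    have h7 : Complex.exp (-δ) * ((Complex.exp (2 * δ) - 1) / (2 * δ)) = Complex.sinh δ / δ := by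
      rw [Complex.sinh, h5]
      field_simp
      linear_combination Complex.exp δ * h6
    have h8 : Complex.exp (-δ) + Complex.sinh δ / δ * δ = Complex.cosh δ := by
      rw [div_mul_cancel₀ _ hδ, Complex.sinh, Complex.cosh]
      ring
    rw [h4, smul_add, smul_smul, h7, ← h8]
    module

end Exponential

/-! ### Rigidity of cosh. -/

section Cosh

theorem exists_sq_eq_of_cosh_eq_zero {z : ℂ} (h : Complex.cosh z = 0) :
    ∃ k : ℤ, z ^ 2 = -((2 * k + 1) ^ 2 * (Real.pi : ℂ) ^ 2 / 4) := by
  rw [← Complex.cos_mul_I, Complex.cos_eq_zero_iff] at h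
  obtain ⟨k, hk⟩ := h
  refine ⟨k, ?_⟩
  have : (z * Complex.I) ^ 2 = ((2 * k + 1) * (Real.pi : ℂ) / 2) ^ 2 := by rw [hk]
  rw [mul_pow, Complex.I_sq] at this
  linear_combination -this

theorem cosh_pi_div_two_mul_I : Complex.cosh (Real.pi / 2 * Complex.I) = 0 := by
  rw [Complex.cosh_mul_I, Complex.cos_pi_div_two]

theorem sinh_pi_div_two_mul_I : Complex.sinh (Real.pi / 2 * Complex.I) = Complex.I := by
  rw [Complex.sinh_mul_I, Complex.sin_pi_div_two, one_mul]

theorem pi_div_two_mul_I_sq :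
    ((Real.pi : ℂ) / 2 * Complex.I) ^ 2 = -((Real.pi : ℂ) ^ 2 / 4) := by
  rw [mul_pow, Complex.I_sq]; ring

/-- If `cosh √(s² + d)` is a linear combination of `cosh s` and `sinh s`, then `d = 0`. -/
theorem eq_zero_of_cosh_eq {d P Q : ℂ}
    (h : ∀ s δ : ℂ, δ ^ 2 = s ^ 2 + d → Complex.cosh δ = P * Complex.cosh s + Q * Complex.sinh s) :
    d = 0 := by
  have hsq (z : ℂ) : ∃ w : ℂ, w ^ 2 = z := IsAlgClosed.exists_pow_nat_eq z two_pos
  have hpi : (Real.pi : ℂ) ≠ 0 := by exact_mod_cast Real.pi_ne_zero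
  -- The points s = ±πi/2 share the same δ, and cosh vanishes at both.
  have hQ : Q = 0 := by
    obtain ⟨δ, hδ⟩ := hsq (((Real.pi : ℂ) / 2 * Complex.I) ^ 2 + d)
    have h1 := h _ δ hδ
    have h2 := h (-((Real.pi : ℂ) / 2 * Complex.I)) δ (by rw [hδ, neg_sq])
    rw [Complex.cosh_neg, Complex.sinh_neg, cosh_pi_div_two_mul_I, sinh_pi_div_two_mul_I] at h2
    rw [cosh_pi_div_two_mul_I, sinh_pi_div_two_mul_I] at h1
    have : Q * Complex.I = 0 := by linear_combination (h2 - h1) / 2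
    simpa using this
  subst hQ
  simp only [zero_mul, add_zero] at h
  have hP : P ≠ 0 := by
    rintro rfl
    obtain ⟨s, hs⟩ := hsq (-d)
    simpa using h s 0 (by rw [hs]; ring)
  -- With P ≠ 0, cosh s and cosh δ vanish together. Taking s = πi/2, then δ = πi/2, makes -π²/4 ± d
  -- both squares of zeros of cosh; adding them leaves a sum of two odd squares equal to 2.
  obtain ⟨δ, hδ⟩ := hsq (((Real.pi : ℂ) / 2 * Complex.I) ^ 2 + d)
  have h1 := h _ δ hδ
  rw [cosh_pi_div_two_mul_I, mul_zero] at h1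
  obtain ⟨s, hs⟩ := hsq (((Real.pi : ℂ) / 2 * Complex.I) ^ 2 - d)
  have h2 := h s ((Real.pi : ℂ) / 2 * Complex.I) (by rw [hs]; ring)
  rw [cosh_pi_div_two_mul_I, eq_comm, mul_eq_zero, or_iff_right hP] at h2
  obtain ⟨k, hk⟩ := exists_sq_eq_of_cosh_eq_zero h1
  obtain ⟨m, hm⟩ := exists_sq_eq_of_cosh_eq_zero h2
  rw [hδ, pi_div_two_mul_I_sq] at hk
  rw [hs, pi_div_two_mul_I_sq] at hm
  have hkm : ((2 * k + 1) ^ 2 + (2 * m + 1) ^ 2 : ℂ) = 2 := by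
    apply mul_right_cancel₀ (pow_ne_zero 2 hpi)
    linear_combination 4 * (hk + hm)
  have hkm' : (2 * k + 1) ^ 2 + (2 * m + 1) ^ 2 = 2 := by exact_mod_cast hkm
  have hk1 : k * (k + 1) = 0 := by
    have hk0 : 0 ≤ k * (k + 1) := by
      rcases le_or_gt 0 k with h | h
      · positivity
      · nlinarith
    have hm0 : 0 ≤ m * (m + 1) := by
      rcases le_or_gt 0 m with h | h
      · positivity
      · nlinarith
    nlinarith
  have hk2 : (k * (k + 1) : ℂ) = 0 := by exact_mod_cast hk1
  linear_combination hk - (Real.pi : ℂ) ^ 2 * hk2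

/-- The function `w ↦ cosh √w` is not affine. -/
theorem eq_zero_of_cosh_eq_affine {b c α β : ℂ}
    (h : ∀ t δ : ℂ, δ ^ 2 = t * b + c → Complex.cosh δ = α + t * β) : b = 0 := by
  by_contra hb
  have hpi : (Real.pi : ℂ) ≠ 0 := by exact_mod_cast Real.pi_ne_zero
  -- As b ≠ 0, every δ occurs. The values 1, -1, 1 at δ² = 0, -π², -4π² are not affine in δ².
  have key (δ : ℂ) : Complex.cosh δ = α + (δ ^ 2 - c) / b * β := h _ δ (by field_simp; ring)
  have h0 := key 0
  have h1 := key (Real.pi * Complex.I)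
  have h2 := key (2 * Real.pi * Complex.I)
  rw [Complex.cosh_zero] at h0
  rw [Complex.cosh_mul_I, Complex.cos_pi, mul_pow, Complex.I_sq] at h1
  rw [Complex.cosh_mul_I, Complex.cos_two_pi, mul_pow, Complex.I_sq] at h2
  have : (6 : ℂ) = 0 := by
    field_simp at h0 h1 h2
    have hh : 8 * b = 0 := by linear_combination 3 * h0 - 4 * h1 + h2
    simp [hb] at hh
  norm_num at this

end Cosh

/-! ### The theorem for 2×2 matrices. -/

section Matrix

local notation "M₂" => Matrix (Fin 2) (Fin 2) ℂ

namespace Matrix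

theorem exp_eq_one_add_of_mul_self_eq_zero {A : M₂} (h : A * A = 0) :
    NormedSpace.exp A = 1 + A := by
  let _ : NormedRing M₂ := Matrix.linftyOpNormedRing
  let _ : NormedAlgebra ℂ M₂ := Matrix.linftyOpNormedAlgebra
  exact _root_.exp_eq_one_add_of_mul_self_eq_zero h

theorem exp_add_smul_one (A : M₂) (z : ℂ) :
    NormedSpace.exp (A + z • (1 : M₂)) = Complex.exp z • NormedSpace.exp A := by
  let _ : NormedRing M₂ := Matrix.linftyOpNormedRing
  let _ : NormedAlgebra ℂ M₂ := Matrix.linftyOpNormedAlgebra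
  exact _root_.exp_add_smul_one A z

theorem exp_of_mul_self_eq_smul {A : M₂} {u : ℂ} (hu : u ≠ 0) (h : A * A = u • A) :
    NormedSpace.exp A = 1 + ((Complex.exp u - 1) / u) • A := by
  let _ : NormedRing M₂ := Matrix.linftyOpNormedRing
  let _ : NormedAlgebra ℂ M₂ := Matrix.linftyOpNormedAlgebra
  exact _root_.exp_of_mul_self_eq_smul hu h

theorem exists_exp_eq_cosh_add (δ : ℂ) :
    ∃ S : ℂ, S * δ = Complex.sinh δ ∧ ∀ A : M₂, A * A = δ ^ 2 • (1 : M₂) →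
      NormedSpace.exp A = Complex.cosh δ • (1 : M₂) + S • A := by
  let _ : NormedRing M₂ := Matrix.linftyOpNormedRing
  let _ : NormedAlgebra ℂ M₂ := Matrix.linftyOpNormedAlgebra
  exact _root_.exists_exp_eq_cosh_add M₂ δ

/-- Polarised Cayley–Hamilton. -/
theorem mul_add_mul_eq_of_trace_eq_zero {A B : M₂} (hA : A.trace = 0) (hB : B.trace = 0) :
    A * B + B * A = (A * B).trace • (1 : M₂) := by
  rw [trace_fin_two] at hA hB
  have hA' := eq_neg_of_add_eq_zero_right hA
  have hB' := eq_neg_of_add_eq_zero_right hB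
  ext i j
  fin_cases i <;> fin_cases j <;> simp [mul_apply, trace_fin_two, hA', hB'] <;> ring

theorem mul_self_eq_of_trace_eq_zero {A : M₂} (hA : A.trace = 0) :
    A * A = ((A * A).trace / 2) • (1 : M₂) := by
  have h := mul_add_mul_eq_of_trace_eq_zero hA hA
  rw [← two_smul ℂ] at h
  rw [div_eq_inv_mul, mul_smul, ← h, smul_smul]
  norm_num

theorem trace_eq_zero_of_mul_self_eq_zero {A : M₂} (h : A * A = 0) : A.trace = 0 := by
  exact (isNilpotent_trace_of_isNilpotent ⟨2, by rw [pow_two, h]⟩).eq_zero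

theorem mul_eq_trace_smul_of_mul_eq_zero {A B : M₂} (hA : A * A = 0) (hAB : A * B = 0) :
    B * A = B.trace • A := by
  have hA' := trace_eq_zero_of_mul_self_eq_zero hA
  have hB : (B - (B.trace / 2) • (1 : M₂)).trace = 0 := by simp
  have h := mul_add_mul_eq_of_trace_eq_zero hA' hB
  have hAC : A * (B - (B.trace / 2) • (1 : M₂)) = -(B.trace / 2) • A := by
    rw [mul_sub, hAB, mul_smul_comm, mul_one]; module
  rw [hAC, trace_smul, hA', smul_zero, zero_smul, sub_mul, smul_mul_assoc, one_mul] at h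
  rw [← sub_eq_zero, ← h]
  module

/-- `B` is singular since a nonzero `A` kills it, so this is Cayley–Hamilton with zero determinant.
-/
theorem mul_self_eq_trace_smul_of_mul_eq_zero {A B : M₂} (hA : A ≠ 0) (hAB : A * B = 0) :
    B * B = B.trace • B := by
  have hdet : B.det = 0 := by
    by_contra hdet
    have hu : IsUnit B := (isUnit_iff_isUnit_det B).2 (isUnit_iff_ne_zero.2 hdet)
    exact hA (hu.mul_left_eq_zero.1 hAB)
  rw [det_fin_two] at hdet
  ext i j
  fin_cases i <;> fin_cases j <;> simp [mul_apply, trace_fin_two] <;>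
    first | ring1 | linear_combination -hdet

theorem cosh_eq_trace_exp {A : M₂} (hA : A.trace = 0) {δ : ℂ} (h : δ ^ 2 = (A * A).trace / 2) :
    2 * Complex.cosh δ = (NormedSpace.exp A).trace := by
  obtain ⟨S, -, hS⟩ := exists_exp_eq_cosh_add δ
  rw [hS A (by rw [h]; exact mul_self_eq_of_trace_eq_zero hA)]
  simp [hA, mul_comm]

theorem mul_comm_of_exp_smul_add_of_mul_self_eq_one {A B : M₂} (hA : A.trace = 0)
    (hB : B.trace = 0) (hA1 : A * A = 1)
    (h : ∀ t : ℂ, NormedSpace.exp (t • A + B) = NormedSpace.exp (t • A) * NormedSpace.exp B) :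
    A * B = B * A := by
  set x := (A * B).trace / 2 with hx
  have hAB : A * B + B * A = (2 * x) • (1 : M₂) := by
    rw [mul_add_mul_eq_of_trace_eq_zero hA hB, hx]; congr 1; ring
  have hBA : (B * A).trace = 2 * x := by rw [trace_mul_comm, hx]; ring
  have hAB' : (A * B).trace = 2 * x := by rw [hx]; ring
  obtain ⟨γ, hγ⟩ := IsAlgClosed.exists_pow_nat_eq ((B * B).trace / 2) two_pos
  have hBB : B * B = γ ^ 2 • (1 : M₂) := by rw [hγ]; exact mul_self_eq_of_trace_eq_zero hB
  obtain ⟨S, -, hS⟩ := exists_exp_eq_cosh_add γ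
  replace hS := hS B hBB
  have hexpA (t : ℂ) : NormedSpace.exp (t • A) =
      Complex.cosh t • (1 : M₂) + Complex.sinh t • A := by
    obtain ⟨T, hT, hT'⟩ := exists_exp_eq_cosh_add t
    rw [hT' _ (by rw [smul_mul_smul_comm, hA1, pow_two]), smul_smul, hT]
  -- With t = s - x the square of tA + B is s² + γ² - x²; `P` and `Q` come from expanding the trace
  -- of the product by the addition formulas.
  have hd : γ ^ 2 - x ^ 2 = 0 := by
    refine eq_zero_of_cosh_eq
      (P := Complex.cosh γ * Complex.cosh x - x * S * Complex.sinh x)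
      (Q := x * S * Complex.cosh x - Complex.cosh γ * Complex.sinh x) fun s δ hδ => ?_
    have h1 : ((s - x) • A + B).trace = 0 := by simp [hA, hB]
    have h2 := cosh_eq_trace_exp h1 (δ := δ) (by
      simp only [mul_add, add_mul, mul_smul_comm, smul_mul_assoc, hA1, hBB, trace_add, trace_smul,
        hBA, hAB', trace_one, Fintype.card_fin, smul_eq_mul, hδ]
      push_cast
      ring)
    rw [h, hexpA, hS] at h2
    simp only [mul_add, add_mul, mul_smul_comm, smul_mul_assoc, trace_add, trace_smul, mul_one,
      one_mul, hA, hB, hAB', trace_one, Fintype.card_fin, smul_eq_mul, Complex.cosh_sub,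
      Complex.sinh_sub] at h2
    push_cast at h2
    linear_combination h2 / 2
  set N := B - x • A with hN
  have hNA : A * N + N * A = 0 := by
    have : A * N + N * A = (A * B + B * A) - (2 * x) • (A * A) := by
      simp only [hN, mul_sub, sub_mul, mul_smul_comm, smul_mul_assoc]; module
    rw [this, hAB, hA1, sub_self]
  have hNN : N * N = 0 := by
    have : N * N = B * B - x • (A * B + B * A) + x ^ 2 • (A * A) := by
      simp only [hN, mul_sub, sub_mul, mul_smul_comm, smul_mul_assoc]; module
    rw [this, hBB, hAB, hA1, sub_eq_zero.1 hd]
    module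
  -- Dividing the identity at πi - x by the one at -x gives exp(πiA + N) = exp(πiA) exp(N). Both
  -- exponentials involving πi are -1, so 1 + N = 1.
  have h1 := h (-x)
  have h2 := h (Real.pi * Complex.I + -x)
  have h3 : NormedSpace.exp ((Real.pi * Complex.I + -x) • A) =
      NormedSpace.exp ((Real.pi * Complex.I : ℂ) • A) * NormedSpace.exp ((-x) • A) := by
    rw [add_smul]
    exact Matrix.exp_add_of_commute _ _ (((Commute.refl A).smul_left _).smul_right _)
  have h4 : (-x) • A + B = N := by rw [hN]; module
  have h5 : (Real.pi * Complex.I + -x) • A + B = (Real.pi * Complex.I : ℂ) • A + N := by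
    rw [hN]; module
  rw [h3, mul_assoc, ← h1, h4, h5, hexpA, Complex.cosh_mul_I, Complex.sinh_mul_I, Complex.cos_pi,
    Complex.sin_pi, exp_eq_one_add_of_mul_self_eq_zero hNN] at h2
  obtain ⟨T, hT, hT'⟩ := exists_exp_eq_cosh_add (Real.pi * Complex.I)
  replace hT' := hT' ((Real.pi * Complex.I : ℂ) • A + N) (by
    have : ((Real.pi * Complex.I : ℂ) • A + N) * ((Real.pi * Complex.I : ℂ) • A + N) =
        (Real.pi * Complex.I : ℂ) ^ 2 • (A * A) + (Real.pi * Complex.I : ℂ) • (A * N + N * A)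
          + N * N := by
      simp only [mul_add, add_mul, mul_smul_comm, smul_mul_assoc]; module
    rw [this, hNA, hNN, hA1]
    simp)
  have hT0 : T = 0 := by
    rw [Complex.sinh_mul_I, Complex.sin_pi, zero_mul] at hT
    simpa [Real.pi_ne_zero] using hT
  rw [hT', hT0, Complex.cosh_mul_I, Complex.cos_pi] at h2
  have hN0 : N = 0 := by simpa [add_mul] using h2
  rw [sub_eq_zero.1 (hN.symm.trans hN0)]
  simp

theorem exists_mul_sub_smul_eq_zero_of_exp_smul_add {A B : M₂} (hA : A.trace = 0)
    (hB : B.trace = 0) (hA0 : A * A = 0) (hne : A * B ≠ B * A)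
    (h : ∀ t : ℂ, NormedSpace.exp (t • A + B) = NormedSpace.exp (t • A) * NormedSpace.exp B) :
    ∃ l : ℂ, A * (B - l • (1 : M₂)) = 0 ∧ (B - l • (1 : M₂)).trace ∈ setU := by
  have hAne : A ≠ 0 := by rintro rfl; simp at hne
  have hexpA (t : ℂ) : NormedSpace.exp (t • A) = 1 + t • A :=
    exp_eq_one_add_of_mul_self_eq_zero (by rw [smul_mul_smul_comm, hA0, smul_zero])
  obtain ⟨γ, hγ⟩ := IsAlgClosed.exists_pow_nat_eq ((B * B).trace / 2) two_pos
  have hBB : B * B = γ ^ 2 • (1 : M₂) := by rw [hγ]; exact mul_self_eq_of_trace_eq_zero hB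
  obtain ⟨S, hSγ, hS'⟩ := exists_exp_eq_cosh_add γ
  have hS := hS' B hBB
  have hb : (A * B).trace = 0 := by
    refine eq_zero_of_cosh_eq_affine (c := γ ^ 2) (α := Complex.cosh γ)
      (β := S * (A * B).trace / 2) fun t δ hδ => ?_
    have h1 : (t • A + B).trace = 0 := by simp [hA, hB]
    have h2 := cosh_eq_trace_exp h1 (δ := δ) (by
      simp only [mul_add, add_mul, mul_smul_comm, smul_mul_assoc, hA0, hBB, trace_add, trace_smul,
        trace_mul_comm B A, trace_one, Fintype.card_fin, smul_eq_mul, hδ, trace_zero]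
      push_cast
      ring)
    rw [h, hexpA, hS] at h2
    simp only [mul_add, add_mul, mul_smul_comm, smul_mul_assoc, trace_add, trace_smul, mul_one,
      one_mul, hA, hB, trace_one, Fintype.card_fin, smul_eq_mul] at h2
    push_cast at h2
    linear_combination h2 / 2
  have hanti : A * B + B * A = 0 := by
    rw [mul_add_mul_eq_of_trace_eq_zero hA hB, hb, zero_smul]
  have h1 := h 1
  have h2 : ((1 : ℂ) • A + B) * ((1 : ℂ) • A + B) = γ ^ 2 • (1 : M₂) := by
    have : ((1 : ℂ) • A + B) * ((1 : ℂ) • A + B) = A * A + (A * B + B * A) + B * B := by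
      rw [one_smul]; noncomm_ring
    rw [this, hA0, hanti, hBB, zero_add, zero_add]
  rw [hS' _ h2, hexpA, hS] at h1
  -- Since (A + B)² = B², both exponentials have the same coefficients cosh γ and S, and most terms
  -- cancel.
  have h3 : S • (A * B) = (S - Complex.cosh γ) • A := by
    simp only [one_smul, add_mul, mul_add, one_mul, mul_smul_comm, mul_one] at h1
    rw [sub_smul, eq_sub_iff_add_eq, ← sub_eq_zero] at *
    rw [← neg_eq_zero, ← h1]
    module
  have hcs := Complex.cosh_sq γ
  -- Otherwise cosh γ = sinh γ = 0, against cosh² - sinh² = 1.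
  have hS0 : S ≠ 0 := by
    rintro rfl
    have hc : Complex.cosh γ = 0 := by simpa [hAne] using h3
    rw [hc, ← hSγ] at hcs
    norm_num at hcs
  obtain ⟨l, hl⟩ : ∃ l : ℂ, S * l = S - Complex.cosh γ := ⟨(S - Complex.cosh γ) / S, by field_simp⟩
  have hABl : A * B = l • A := by
    rw [← hl, mul_smul] at h3
    exact smul_right_injective _ hS0 h3
  have hlγ : l ^ 2 = γ ^ 2 := by
    have h4 : A * (B * B) = (l ^ 2) • A := by
      rw [← mul_assoc, hABl, smul_mul_assoc, hABl, smul_smul, pow_two]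
    rw [hBB, mul_smul_comm, mul_one] at h4
    exact (smul_left_injective ℂ hAne h4).symm
  have hl0 : l ≠ 0 := by
    rintro rfl
    rw [zero_smul] at hABl
    rw [hABl, zero_add] at hanti
    exact hne (hABl.trans hanti.symm)
  have htr : (B - l • (1 : M₂)).trace = -(2 * l) := by simp [hB, mul_comm]
  -- The sign of γ is immaterial, as cosh γ and sinh γ / γ are even.
  have hcl : Complex.cosh γ = Complex.cosh l ∧ S * l = Complex.sinh l := by
    rcases sq_eq_sq_iff_eq_or_eq_neg.1 hlγ with rfl | rfl
    · exact ⟨rfl, hSγ⟩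
    · rw [Complex.cosh_neg, Complex.sinh_neg, mul_neg, hSγ]
      exact ⟨rfl, rfl⟩
  have hSexp : S = Complex.exp l := by
    rw [← Complex.cosh_add_sinh, ← hcl.1, ← hcl.2, hl]; ring
  refine ⟨l, by rw [mul_sub, hABl, mul_smul_comm, mul_one, sub_self], ?_⟩
  rw [htr]
  refine ⟨neg_ne_zero.2 (mul_ne_zero two_ne_zero hl0), ?_⟩
  have h5 := hcl.2
  rw [hSexp, Complex.sinh] at h5
  have h6 : Complex.exp (-l) * Complex.exp l = 1 := by rw [← Complex.exp_add]; simp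
  have h7 : Complex.exp (-(2 * l)) = Complex.exp (-l) * Complex.exp (-l) := by
    rw [← Complex.exp_add]; ring_nf
  rw [h7]
  linear_combination 2 * Complex.exp (-l) * h5 + (1 - 2 * l) * h6

theorem exp_smul_add_eq_mul_iff (A B : M₂) (σ τ t : ℂ) :
    NormedSpace.exp (t • (A + σ • (1 : M₂)) + (B + τ • (1 : M₂))) =
        NormedSpace.exp (t • (A + σ • (1 : M₂))) * NormedSpace.exp (B + τ • (1 : M₂)) ↔
      NormedSpace.exp (t • A + B) = NormedSpace.exp (t • A) * NormedSpace.exp B := by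
  have h1 : t • (A + σ • (1 : M₂)) + (B + τ • (1 : M₂)) =
      (t • A + B) + (t * σ + τ) • (1 : M₂) := by module
  have h2 : t • (A + σ • (1 : M₂)) = t • A + (t * σ) • (1 : M₂) := by module
  rw [h1, h2, exp_add_smul_one, exp_add_smul_one, exp_add_smul_one, smul_mul_smul_comm,
    ← Complex.exp_add]
  exact (smul_right_injective _ (Complex.exp_ne_zero _)).eq_iff

theorem add_smul_one_commute_iff (A B : M₂) (σ τ : ℂ) :
    (A + σ • (1 : M₂)) * (B + τ • (1 : M₂)) = (B + τ • (1 : M₂)) * (A + σ • (1 : M₂)) ↔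
      A * B = B * A := by
  rw [← sub_eq_zero, ← sub_eq_zero (a := A * B)]
  have : (A + σ • (1 : M₂)) * (B + τ • (1 : M₂)) - (B + τ • (1 : M₂)) * (A + σ • (1 : M₂)) =
      A * B - B * A := by
    simp only [add_mul, mul_add, smul_mul_assoc, mul_smul_comm, one_mul, mul_one]
    module
  rw [this]

theorem exp_smul_add_of_mul_eq_zero {A B : M₂} (hA : A ≠ 0) (hAA : A * A = 0) (hAB : A * B = 0)
    (hB : B.trace ∈ setU) (t : ℂ) :
    NormedSpace.exp (t • A + B) = NormedSpace.exp (t • A) * NormedSpace.exp B := by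
  obtain ⟨hu, hexp⟩ := hB
  have hBA := mul_eq_trace_smul_of_mul_eq_zero hAA hAB
  have hBB := mul_self_eq_trace_smul_of_mul_eq_zero hA hAB
  have h1 : (t • A + B) * (t • A + B) = B.trace • (t • A + B) := by
    simp only [add_mul, mul_add, smul_mul_assoc, mul_smul_comm, hAA, hAB, hBA, hBB]
    module
  have h2 : (Complex.exp B.trace - 1) / B.trace = 1 := by
    rw [hexp, add_sub_cancel_left, div_self hu]
  rw [exp_of_mul_self_eq_smul hu h1, exp_of_mul_self_eq_smul hu hBB, h2,
    exp_eq_one_add_of_mul_self_eq_zero (A := t • A) (by simp [hAA])]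
  simp only [add_mul, mul_add, one_smul, smul_mul_assoc, hAB, one_mul, mul_one]
  module

/-- If A² = α² ≠ 0, replacing A by A/α only rescales t, which ranges over all of ℂ. -/
theorem mul_self_eq_zero_of_exp_smul_add {A B : M₂} (hA : A.trace = 0) (hB : B.trace = 0)
    (hne : A * B ≠ B * A)
    (h : ∀ t : ℂ, NormedSpace.exp (t • A + B) = NormedSpace.exp (t • A) * NormedSpace.exp B) :
    A * A = 0 := by
  obtain ⟨α, hα⟩ := IsAlgClosed.exists_pow_nat_eq ((A * A).trace / 2) two_pos
  have hAA := mul_self_eq_of_trace_eq_zero hA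
  rw [← hα] at hAA
  rcases eq_or_ne α 0 with rfl | hα0
  · simpa using hAA
  · have hcomm := mul_comm_of_exp_smul_add_of_mul_self_eq_one (A := α⁻¹ • A) (B := B)
      (by simp [hA]) hB
      (by rw [smul_mul_smul_comm, hAA, smul_smul]; field_simp; simp)
      (fun t => by rw [smul_smul]; exact h _)
    rw [smul_mul_assoc, mul_smul_comm] at hcomm
    exact absurd (smul_right_injective _ (inv_ne_zero hα0) hcomm) hne

theorem exp_smul_add_eq_mul_forall_iff (F G : M₂) :
    (F * G ≠ G * F ∧
      ∀ t : ℂ, NormedSpace.exp (t • F + G) = NormedSpace.exp (t • F) * NormedSpace.exp G) ↔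
    ∃ σ τ : ℂ, F - σ • (1 : M₂) ≠ 0 ∧ (F - σ • (1 : M₂)) * (F - σ • (1 : M₂)) = 0 ∧
      (F - σ • (1 : M₂)) * (G - τ • (1 : M₂)) = 0 ∧ (G - τ • (1 : M₂)).trace ∈ setU := by
  constructor
  · rintro ⟨hne, h⟩
    obtain ⟨A, hA⟩ : ∃ A, A = F - (F.trace / 2) • (1 : M₂) := ⟨_, rfl⟩
    obtain ⟨B, hB⟩ : ∃ B, B = G - (G.trace / 2) • (1 : M₂) := ⟨_, rfl⟩
    have hA0 : A.trace = 0 := by simp [hA]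
    have hB0 : B.trace = 0 := by simp [hB]
    have hF : F = A + (F.trace / 2) • (1 : M₂) := by rw [hA, sub_add_cancel]
    have hG : G = B + (G.trace / 2) • (1 : M₂) := by rw [hB, sub_add_cancel]
    rw [hF, hG, Ne, add_smul_one_commute_iff] at hne
    have h' (t : ℂ) :
        NormedSpace.exp (t • A + B) = NormedSpace.exp (t • A) * NormedSpace.exp B := by
      have := h t
      rwa [hF, hG, exp_smul_add_eq_mul_iff] at this
    have hAA := mul_self_eq_zero_of_exp_smul_add hA0 hB0 hne h'
    obtain ⟨l, hl, hU⟩ := exists_mul_sub_smul_eq_zero_of_exp_smul_add hA0 hB0 hAA hne h'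
    have hG' : G - (G.trace / 2 + l) • (1 : M₂) = B - l • (1 : M₂) := by rw [hB]; module
    refine ⟨F.trace / 2, G.trace / 2 + l, ?_⟩
    rw [hG', ← hA]
    exact ⟨by rintro rfl; simp at hne, hAA, hl, hU⟩
  · rintro ⟨σ, τ, hne, hAA, hAB, hU⟩
    have hF : F = (F - σ • (1 : M₂)) + σ • (1 : M₂) := by rw [sub_add_cancel]
    have hG : G = (G - τ • (1 : M₂)) + τ • (1 : M₂) := by rw [sub_add_cancel]
    constructor
    · rw [hF, hG, Ne, add_smul_one_commute_iff, hAB, mul_eq_trace_smul_of_mul_eq_zero hAA hAB]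
      exact (smul_ne_zero hU.1 hne).symm
    · intro t
      rw [hF, hG, exp_smul_add_eq_mul_iff]
      exact exp_smul_add_of_mul_eq_zero hne hAA hAB hU t

end Matrix

end Matrix
-- Transfer to endomorphisms through a basis.
theorem theorem2 {E : Type*} [AddCommGroup E] [Module ℂ E] (hE : Module.finrank ℂ E = 2)
    (f g : Module.End ℂ E) :
    (f ∘ₗ g ≠ g ∘ₗ f ∧ ∀ t : ℂ, endExp (t • f + g) = endExp (t • f) ∘ₗ endExp g) ↔
      ∃ (σ τ : ℂ) (f' g' : Module.End ℂ E),
        f' = f - σ • LinearMap.id ∧ g' = g - τ • LinearMap.id ∧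
        f' ≠ 0 ∧ f' ∘ₗ f' = 0 ∧ f' ∘ₗ g' = 0 ∧ LinearMap.trace ℂ E g' ∈ setU := by
  have : FiniteDimensional ℂ E := Module.finite_of_finrank_eq_succ hE
  let b : Module.Basis (Fin 2) ℂ E := Module.finBasisOfFinrankEq ℂ E hE
  let e : Module.End ℂ E ≃ₗ[ℂ] Matrix (Fin 2) (Fin 2) ℂ := LinearMap.toMatrix b b
  have hcomp (x y : Module.End ℂ E) : e (x ∘ₗ y) = e x * e y := LinearMap.toMatrix_comp b b b x y
  have hid : e LinearMap.id = 1 := LinearMap.toMatrix_id b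
  have hexp (x : Module.End ℂ E) : e (endExp x) = NormedSpace.exp (e x) := toMatrix_endExp b x
  have htr (x : Module.End ℂ E) : LinearMap.trace ℂ E x = (e x).trace :=
    LinearMap.trace_eq_matrix_trace ℂ b x
  have key := Matrix.exp_smul_add_eq_mul_forall_iff (e f) (e g)
  simp only [← hid, ← map_smul, ← map_sub, ← map_add, ← hcomp, ← hexp, ← htr, ne_eq,
    e.injective.eq_iff, map_eq_zero_iff e e.injective] at key
  rw [ne_eq, key]
  simp only [exists_and_left, exists_eq_left, ne_eq]
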